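/- Let $\operatorname{Log}$ be the principal logarithm on $\mathcal A=\mathbb C\setminus(-\infty,0]$ and let $$G(z)=\Bigl(1-\frac{\operatorname{Log} z}{\operatorname{Log}(1+z)}\Bigr)z\operatorname{Log} z,\qquad z\in\mathcal A.$$ Let $$\rho(t)=\begin{cases}-\dfrac{t\ln((1-t)/t^2)}{\ln(1-t)}, & 0<t<1,\\[2mm] -1, & t=1,\\[1mm] -\dfrac{t\,(\ln((t-1)/t))^2}{(\ln(t-1))^2+\pi^2}, & t>1,\end{cases}\qquad \varphi(s)=\int_0^\infty e^{-st}\rho(t)\,dt,\quad s\ge 0.$$ A function $F:\mathbb R\to\mathbb C$ is called positive definite if for all $n$ and all $x_1,\dots,x_n\in\mathbb R$ the matrix $(F(x_i-x_j))_{i,j}$ is Hermitian positive semidefinite, and negative definite if for all $n$ and all $x_1,\dots,x_n\in\mathbb R$ the matrix $(F(x_i)+\overline{F(x_j)}-F(x_i-x_j))_{i,j}$ is Hermitian positive semidefinite. The integral defining $\varphi(s)$ converges absolutely for every $s\ge 0$, and the following hold. (i) For each $a>0$, the function $t\mapsto 1-G(a+it)$ is real-analytic and positive definite on $\mathbb R$,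 and it is the Fourier transform of the integrable function $s\mapsto e^{-as}\varphi(s)1_{[0,\infty)}(s)$, that is, $$1-G(a+it)=\int_0^\infty e^{-its}e^{-as}\varphi(s)\,ds,\qquad t\in\mathbb R.$$ (ii) For each $a>0$, the function $t\mapsto G(a+it)-G(a)$ is continuous and negative definite on $\mathbb R$. In particular, $G(a)$ being real, $\operatorname{Re}G(a+it)\ge G(a)$ for all $t\in\mathbb R$. (iii) For each $a\ge 1$, the function $t\mapsto G(a+it)$ is continuous and negative definite on $\mathbb R$. -/

import Mathlib

open MeasureTheory Set
open scoped ComplexOrder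

noncomputable section

namespace AlzerG

/-- The function `G(z) = (1 - Log z / Log (1 + z)) z Log z` (principal logarithm). -/
def G (z : ℂ) : ℂ :=
  (1 - Complex.log z / Complex.log (1 + z)) * z * Complex.log z

/-- The function `ρ` on the positive half-line, extended continuously by `-1` at `1`.
Its values outside `(0, ∞)` are never used. -/
def rho (t : ℝ) : ℝ :=
  if t < 1 then -(t * Real.log ((1 - t) / t ^ 2) / Real.log (1 - t))
  else if t = 1 then -1
  else -(t * Real.log ((t - 1) / t) ^ 2 / (Real.log (t - 1) ^ 2 + Real.pi ^ 2))

/-- The Laplace transform `φ(s) = ∫₀^∞ e^{-st} ρ(t) dt`. -/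
def phi (s : ℝ) : ℝ :=
  ∫ t in Ioi (0 : ℝ), Real.exp (-s * t) * rho t

/-- The function `s ↦ e^{-as} φ(s) 1_{[0,∞)}(s)` on the real line. -/
def density (a : ℝ) : ℝ → ℝ :=
  indicator (Ici (0 : ℝ)) (fun s => Real.exp (-a * s) * phi s)

/-- The Fourier transform `t ↦ ∫ e^{-its} f(s) ds` of a real-valued function on the line. -/
def fourierTransform (f : ℝ → ℝ) (t : ℝ) : ℂ :=
  ∫ s : ℝ, Complex.exp (-(Complex.I * t * s)) * (f s : ℂ)

/-- `f : ℝ → ℂ` is positive definite if all the matrices `(f (x i - x j))` are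
Hermitian and positive semidefinite. -/
def IsPositiveDefinite (f : ℝ → ℂ) : Prop :=
  ∀ (n : ℕ) (x : Fin n → ℝ), (Matrix.of fun i j => f (x i - x j)).PosSemidef

/-- `f : ℝ → ℂ` is negative definite (in the sense of Schoenberg) if all the matrices
`(f (x i) + conj (f (x j)) - f (x i - x j))` are Hermitian and positive semidefinite. -/
def IsNegativeDefinite (f : ℝ → ℂ) : Prop :=
  ∀ (n : ℕ) (x : Fin n → ℝ),
    (Matrix.of fun i j => f (x i) + starRingEnd ℂ (f (x j)) - f (x i - x j)).PosSemidef

end AlzerG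

end

/-!
The function `1 - G` is holomorphic in the upper half-plane, continuous up to the boundary away from
`0`, blows up slower than `1 / z` at `0`, decays like `1 / z` at infinity and is real on `(0, ∞)`.
Cauchy's formula for the half-plane therefore recovers it from its imaginary part on `(-∞, 0)`,
which gives the Stieltjes representation `1 - G z = ∫₀^∞ ρ(t) / (t + z) dt` with
`ρ(t) = Im G(-t) / π`.
As `1 / (t + z) = ∫₀^∞ e^{-(t + z) s} ds`, this says that `1 - G` is the Laplace transform of `φ`,
itself the Laplace transform of `ρ`.

The function `ρ` changes sign exactly once, from plus to minus, and its integral, the limit of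
`a (1 - G a)` as `a → ∞`, is nonnegative. Hence `φ ≥ 0`, so on each vertical line `1 - G` is the
Fourier transform of a nonnegative integrable function and is positive definite. Consequently
`G(a + i t) - G a` is negative definite, and so is `G(a + i t)` as soon as `G a ≥ 0`, in particular
for `a ≥ 1`.
-/

noncomputable section

namespace AlzerG

open Filter Topology Asymptotics Bornology
open scoped ComplexConjugate

section Contour

variable {E : Type*} [NormedAddCommGroup E] [NormedSpace ℂ E]

theorem tendsto_verticalIntegral_zero {F : ℂ → E} {b : ℝ} (hb : 0 ≤ b)
    (hlim : Tendsto F (comap Complex.re (cocompact ℝ) ⊓ 𝓟 (univ ×ℂ Icc 0 b)) (𝓝 0)) :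
    Tendsto (fun x : ℝ => ∫ y in (0 : ℝ)..b, F (x + y * Complex.I)) (cocompact ℝ) (𝓝 0) := by
  rw [Metric.tendsto_nhds]
  intro ε hε
  have hsmall : ∀ᶠ w in comap Complex.re (cocompact ℝ) ⊓ 𝓟 (univ ×ℂ Icc 0 b),
      ‖F w‖ < ε / (b + 1) := by
    simpa using Metric.tendsto_nhds.1 hlim (ε / (b + 1)) (by positivity)
  rw [eventually_inf_principal, eventually_comap] at hsmall
  filter_upwards [hsmall] with x hx
  rw [dist_zero_right]
  calc ‖∫ y in (0 : ℝ)..b, F (x + y * Complex.I)‖ ≤ ε / (b + 1) * |b - 0| :=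
        intervalIntegral.norm_integral_le_of_norm_le_const fun y hy => by
          rw [uIoc_of_le hb] at hy
          exact (hx _ (by simp) (by simpa [Complex.mem_reProdIm] using Ioc_subset_Icc_self hy)).le
    _ = ε * (b / (b + 1)) := by rw [sub_zero, abs_of_nonneg hb]; ring
    _ < ε := mul_lt_of_lt_one_right hε ((div_lt_one (by positivity)).2 (lt_add_one b))

theorem integral_eq_integral_add_mul_I [CompleteSpace E] {F : ℂ → E} {b : ℝ} (hb : 0 ≤ b)
    (hcont : ContinuousOn F (univ ×ℂ Icc 0 b)) (hdiff : DifferentiableOn ℂ F (univ ×ℂ Ioo 0 b))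
    (hbot : Integrable fun x : ℝ => F x) (htop : Integrable fun x : ℝ => F (x + b * Complex.I))
    (hlim : Tendsto F (comap Complex.re (cocompact ℝ) ⊓ 𝓟 (univ ×ℂ Icc 0 b)) (𝓝 0)) :
    ∫ x : ℝ, F x = ∫ x : ℝ, F (x + b * Complex.I) := by
  have hrect (R : ℝ) : (∫ x in -R..R, F x) - (∫ x in -R..R, F (x + b * Complex.I)) +
      Complex.I • (∫ y in (0 : ℝ)..b, F (R + y * Complex.I)) -
      Complex.I • (∫ y in (0 : ℝ)..b, F ((-R : ℝ) + y * Complex.I)) = 0 := by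
    have h := Complex.integral_boundary_rect_eq_zero_of_continuousOn_of_differentiableOn F
      (-R : ℝ) (R + b * Complex.I)
      (hcont.mono (Complex.reProdIm_subset_iff.2
        (prod_mono (subset_univ _) (by simp [uIcc_of_le hb]))))
      (hdiff.mono (Complex.reProdIm_subset_iff.2 (prod_mono (subset_univ _) (by simp [hb]))))
    simpa using h
  have hvert := tendsto_verticalIntegral_zero hb hlim
  rw [cocompact_eq_atBot_atTop, tendsto_sup] at hvert
  have hlimit := (((intervalIntegral_tendsto_integral hbot tendsto_neg_atTop_atBot tendsto_id).sub
    (intervalIntegral_tendsto_integral htop tendsto_neg_atTop_atBot tendsto_id)).add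
    (hvert.2.const_smul Complex.I)).sub
    ((hvert.1.comp tendsto_neg_atTop_atBot).const_smul Complex.I)
  simpa [sub_eq_zero] using tendsto_nhds_unique hlimit (tendsto_const_nhds.congr fun R =>
    (hrect R).symm)

end Contour

section HalfLine

variable {E : Type*} [NormedAddCommGroup E]

theorem integrable_iff_integrableOn_Ioi_comp_neg {f : ℝ → E} :
    Integrable f ↔ IntegrableOn f (Ioi 0) ∧ IntegrableOn (fun x => f (-x)) (Ioi 0) := by
  have hneg : IntegrableOn (fun x => f (-x)) (Ioi 0) ↔ IntegrableOn f (Iic 0) := by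
    rw [integrableOn_Iic_iff_integrableOn_Iio]
    simpa [Function.comp_def] using
      (Measure.measurePreserving_neg (volume : Measure ℝ)).integrableOn_comp_preimage
        (MeasurableEquiv.neg ℝ).measurableEmbedding (f := f) (s := Iio 0)
  rw [hneg, ← integrableOn_union, union_comm, Iic_union_Ioi, integrableOn_univ]

variable [NormedSpace ℝ E]

theorem integral_eq_integral_Ioi_add_comp_neg {f : ℝ → E} (hf : Integrable f) :
    ∫ x, f x = (∫ x in Ioi 0, f x) + ∫ x in Ioi 0, f (-x) := by
  rw [integral_comp_neg_Ioi, neg_zero, add_comm,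
    intervalIntegral.integral_Iic_add_Ioi hf.integrableOn hf.integrableOn]

theorem integrable_exp_smul_comp_exp_iff {g : ℝ → E} :
    Integrable (fun x => Real.exp x • g (Real.exp x)) ↔ IntegrableOn g (Ioi 0) := by
  simpa [Real.range_exp] using (integrableOn_image_iff_integrableOn_abs_deriv_smul
    MeasurableSet.univ (fun x _ => (Real.hasDerivAt_exp x).hasDerivWithinAt)
    Real.exp_injective.injOn g).symm

theorem integral_exp_smul_comp_exp (g : ℝ → E) :
    ∫ x, Real.exp x • g (Real.exp x) = ∫ u in Ioi 0, g u := by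
  simpa [Real.range_exp] using (integral_image_eq_integral_abs_deriv_smul
    MeasurableSet.univ (fun x _ => (Real.hasDerivAt_exp x).hasDerivWithinAt)
    Real.exp_injective.injOn g).symm

end HalfLine

/-- The closed upper half-plane without the origin, the image of the strip `0 ≤ Im ζ ≤ π` under
`exp`. The origin is removed because the functions to be integrated may blow up there. -/
def puncturedHalfPlane : Set ℂ := {w | 0 ≤ w.im ∧ w ≠ 0}

theorem ofReal_mem_puncturedHalfPlane {x : ℝ} (hx : x ≠ 0) : (x : ℂ) ∈ puncturedHalfPlane :=
  ⟨by simp, by exact_mod_cast hx⟩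

theorem mem_puncturedHalfPlane_of_im_pos {z : ℂ} (hz : 0 < z.im) : z ∈ puncturedHalfPlane :=
  ⟨hz.le, fun h => by simp [h] at hz⟩

theorem mapsTo_exp_puncturedHalfPlane :
    MapsTo Complex.exp (univ ×ℂ Icc 0 Real.pi) puncturedHalfPlane := fun ζ hζ => by
  rw [Complex.mem_reProdIm] at hζ
  refine ⟨?_, Complex.exp_ne_zero ζ⟩
  rw [Complex.exp_im]
  exact mul_nonneg (Real.exp_pos _).le (Real.sin_nonneg_of_mem_Icc hζ.2)

theorem exp_im_pos {ζ : ℂ} (hζ : ζ.im ∈ Ioo 0 Real.pi) : 0 < (Complex.exp ζ).im := by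
  rw [Complex.exp_im]
  exact mul_pos (Real.exp_pos _) (Real.sin_pos_of_mem_Ioo hζ)

section CauchyHalfPlane

variable {E : Type*} [NormedAddCommGroup E] [NormedSpace ℂ E]

theorem tendsto_exp_smul_comp_exp {k : ℂ → E}
    (hzero : Tendsto (fun w => w • k w) (𝓝[puncturedHalfPlane] 0) (𝓝 0))
    (hinfty : Tendsto (fun w => w • k w) (cobounded ℂ ⊓ 𝓟 puncturedHalfPlane) (𝓝 0)) :
    Tendsto (fun ζ => Complex.exp ζ • k (Complex.exp ζ))
      (comap Complex.re (cocompact ℝ) ⊓ 𝓟 (univ ×ℂ Icc 0 Real.pi)) (𝓝 0) := by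
  have hmaps := tendsto_principal_principal.2 mapsTo_exp_puncturedHalfPlane
  rw [cocompact_eq_atBot_atTop, comap_sup, inf_sup_right, tendsto_sup]
  exact ⟨hzero.comp ((Complex.comap_exp_nhds_zero ▸ tendsto_comap).inf hmaps),
    hinfty.comp (Complex.tendsto_exp_comap_re_atTop.inf hmaps)⟩

/- The substitution `w = exp ζ` turns the half-plane into the strip `0 < Im ζ < π`. The two edges
of the strip are the two halves of the real line. -/
theorem integral_eq_zero_of_tendsto_smul_zero [CompleteSpace E] {k : ℂ → E}
    (hcont : ContinuousOn k puncturedHalfPlane) (hdiff : DifferentiableOn ℂ k {w | 0 < w.im})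
    (hzero : Tendsto (fun w => w • k w) (𝓝[puncturedHalfPlane] 0) (𝓝 0))
    (hinfty : Tendsto (fun w => w • k w) (cobounded ℂ ⊓ 𝓟 puncturedHalfPlane) (𝓝 0))
    (hint : Integrable fun x : ℝ => k x) : ∫ x : ℝ, k x = 0 := by
  obtain ⟨hpos, hneg⟩ := integrable_iff_integrableOn_Ioi_comp_neg.1 hint
  set F : ℂ → E := fun ζ => Complex.exp ζ • k (Complex.exp ζ) with hF
  have hbot : (fun x : ℝ => F x) = fun x => Real.exp x • k (Real.exp x : ℝ) := by
    funext x
    simp [hF, ← Complex.ofReal_exp]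
  have htop : (fun x : ℝ => F (x + Real.pi * Complex.I)) =
      fun x => -(Real.exp x • k (-Real.exp x : ℝ)) := by
    funext x
    simp [hF, Complex.exp_add, ← Complex.ofReal_exp]
  have hshift : ∫ x : ℝ, F x = ∫ x : ℝ, F (x + Real.pi * Complex.I) := by
    refine integral_eq_integral_add_mul_I Real.pi_pos.le ?_ ?_ ?_ ?_
      (tendsto_exp_smul_comp_exp hzero hinfty)
    · exact Complex.continuous_exp.continuousOn.smul
        (hcont.comp Complex.continuous_exp.continuousOn mapsTo_exp_puncturedHalfPlane)
    · exact Complex.differentiable_exp.differentiableOn.smul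
        (hdiff.comp Complex.differentiable_exp.differentiableOn fun ζ hζ => exp_im_pos hζ.2)
    · rw [hbot]
      exact integrable_exp_smul_comp_exp_iff.2 hpos
    · rw [htop]
      exact (integrable_exp_smul_comp_exp_iff.2 hneg).neg
  rw [hbot, htop, integral_neg, integral_exp_smul_comp_exp fun u : ℝ => k u,
    integral_exp_smul_comp_exp fun u : ℝ => k (-u : ℝ)] at hshift
  rw [integral_eq_integral_Ioi_add_comp_neg hint, hshift, neg_add_cancel]

end CauchyHalfPlane

section CauchyFormula

variable {f : ℂ → ℂ} {z : ℂ}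

theorem ofReal_sub_ne_zero (hz : z.im ≠ 0) (x : ℝ) : (x : ℂ) - z ≠ 0 := fun h =>
  hz (by simpa using congrArg Complex.im h)

theorem sub_ne_zero_of_im_neg {w : ℂ} (hz : z.im < 0) (hw : 0 ≤ w.im) : w - z ≠ 0 :=
  sub_ne_zero.2 fun h => hz.not_ge (h ▸ hw)

theorem inv_sub_mul_sub_conj (hz : z.im ≠ 0) (x : ℝ) :
    (((x : ℂ) - z) * (x - conj z))⁻¹ =
      ((z.im ^ 2)⁻¹ * (1 + ((x - z.re) / z.im) ^ 2)⁻¹ : ℝ) := by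
  have hreal : ((x : ℂ) - z) * (x - conj z) = ((x - z.re) ^ 2 + z.im ^ 2 : ℝ) := by
    exact Complex.ext (by simp [pow_two]) (by simp [pow_two]; ring)
  rw [hreal, ← Complex.ofReal_inv, ← mul_inv]
  congr 2
  field_simp
  ring

theorem integrable_inv_sub_mul_sub_conj (hz : z.im ≠ 0) :
    Integrable fun x : ℝ => (((x : ℂ) - z) * (x - conj z))⁻¹ := by
  simp only [inv_sub_mul_sub_conj hz]
  exact (((integrable_inv_one_add_sq.comp_div hz).comp_sub_right z.re).const_mul _).ofReal

theorem integral_inv_sub_mul_sub_conj (hz : 0 < z.im) :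
    ∫ x : ℝ, (((x : ℂ) - z) * (x - conj z))⁻¹ = Real.pi / z.im := by
  simp only [inv_sub_mul_sub_conj hz.ne']
  rw [integral_complex_ofReal, integral_const_mul,
    integral_sub_right_eq_self (fun x : ℝ => (1 + (x / z.im) ^ 2)⁻¹) z.re,
    Measure.integral_comp_div (fun x : ℝ => (1 + x ^ 2)⁻¹) z.im, integral_univ_inv_one_add_sq,
    abs_of_pos hz, smul_eq_mul, ← Complex.ofReal_div]
  congr 1
  field_simp

theorem tendsto_div_sub_cobounded (c : ℂ) :
    Tendsto (fun w => w / (w - c)) (cobounded ℂ) (𝓝 1) := by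
  have h : Tendsto (fun w => 1 + c * (w - c)⁻¹) (cobounded ℂ) (𝓝 (1 + c * 0)) :=
    ((tendsto_inv₀_cobounded.comp (tendsto_sub_const_cobounded c)).const_mul c).const_add 1
  rw [mul_zero, add_zero] at h
  refine h.congr' ?_
  filter_upwards [eventually_ne_cobounded c] with w hw
  have := sub_ne_zero.2 hw
  field_simp
  ring

theorem tendsto_sub_nhdsWithin_zero (c : ℂ) :
    Tendsto (fun w => w - c) (𝓝[puncturedHalfPlane] 0) (𝓝 (-c)) := by
  simpa using ((continuous_sub_right c).tendsto (0 : ℂ)).mono_left nhdsWithin_le_nhds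

/-- Functions on the closed upper half-plane, with a singularity at the origin allowed, to which
Cauchy's formula applies: continuous up to the boundary, holomorphic inside, with `f w = o(1 / w)`
at the origin and `f w = o(1)` at infinity. -/
structure IsCauchyAdmissible (f : ℂ → ℂ) : Prop where
  continuousOn : ContinuousOn f puncturedHalfPlane
  differentiableOn : DifferentiableOn ℂ f {w | 0 < w.im}
  tendsto_mul_zero : Tendsto (fun w => w * f w) (𝓝[puncturedHalfPlane] 0) (𝓝 0)
  tendsto_cobounded : Tendsto f (cobounded ℂ ⊓ 𝓟 puncturedHalfPlane) (𝓝 0)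

theorem integral_div_sub_of_im_neg (hf : IsCauchyAdmissible f) (hz : z.im < 0)
    (hint : Integrable fun x : ℝ => f x / (x - z)) : ∫ x : ℝ, f x / (x - z) = 0 := by
  refine integral_eq_zero_of_tendsto_smul_zero (k := fun w => f w / (w - z)) ?_ ?_ ?_ ?_ hint
  · exact hf.continuousOn.div (by fun_prop) fun w hw => sub_ne_zero_of_im_neg hz hw.1
  · exact hf.differentiableOn.div (by fun_prop) fun w hw => sub_ne_zero_of_im_neg hz (le_of_lt hw)
  · have hz0 : -z ≠ 0 := neg_ne_zero.2 fun h => by simp [h] at hz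
    simpa [Pi.div_def, ← mul_div_assoc] using
      hf.tendsto_mul_zero.div (tendsto_sub_nhdsWithin_zero z) hz0
  · simpa [mul_div_left_comm] using
      hf.tendsto_cobounded.mul ((tendsto_div_sub_cobounded z).mono_left inf_le_left)

/-- The function `w ↦ f w / (w - z)` with its residue at `z` moved to `conj z`, that is,
`f w / (w - z) - f z * (1 / (w - z) - 1 / (w - conj z))`. It is holomorphic in the upper half-plane
and it is `o(1 / w)` at infinity, as Cauchy's theorem requires. -/
def reflectedCauchyIntegrand (f : ℂ → ℂ) (z w : ℂ) : ℂ :=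
  dslope f z w + f z / (w - conj z)

theorem reflectedCauchyIntegrand_of_ne {w : ℂ} (hw : w ≠ z) :
    reflectedCauchyIntegrand f z w = (f w - f z) / (w - z) + f z / (w - conj z) := by
  rw [reflectedCauchyIntegrand, dslope_of_ne _ hw, slope_def_field]

theorem reflectedCauchyIntegrand_ofReal (hz : z.im ≠ 0) (x : ℝ) :
    reflectedCauchyIntegrand f z x =
      f x / (x - z) - 2 * Complex.I * z.im * f z * (((x : ℂ) - z) * (x - conj z))⁻¹ := by
  have hx := ofReal_sub_ne_zero hz x
  have hx' : (x : ℂ) - conj z ≠ 0 := ofReal_sub_ne_zero (by simpa using hz) x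
  have hsub : 2 * Complex.I * z.im = z - conj z := by rw [Complex.sub_conj]; push_cast; ring
  rw [reflectedCauchyIntegrand_of_ne (sub_ne_zero.1 hx), hsub]
  field_simp
  ring

theorem setOf_im_pos_mem_nhds (hz : 0 < z.im) : {w : ℂ | 0 < w.im} ∈ 𝓝 z :=
  (isOpen_lt continuous_const Complex.continuous_im).mem_nhds hz

theorem continuousOn_reflectedCauchyIntegrand (hz : 0 < z.im)
    (hcont : ContinuousOn f puncturedHalfPlane) (hdiff : DifferentiableAt ℂ f z) :
    ContinuousOn (reflectedCauchyIntegrand f z) puncturedHalfPlane :=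
  ((continuousOn_dslope (mem_of_superset (setOf_im_pos_mem_nhds hz) fun _ hw =>
    mem_puncturedHalfPlane_of_im_pos hw)).2 ⟨hcont, hdiff⟩).add
    (continuousOn_const.div (by fun_prop) fun _ hw =>
      sub_ne_zero_of_im_neg (by simpa using hz) hw.1)

theorem differentiableOn_reflectedCauchyIntegrand (hz : 0 < z.im)
    (hdiff : DifferentiableOn ℂ f {w | 0 < w.im}) :
    DifferentiableOn ℂ (reflectedCauchyIntegrand f z) {w | 0 < w.im} :=
  ((Complex.differentiableOn_dslope (setOf_im_pos_mem_nhds hz)).2 hdiff).add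
    ((differentiableOn_const _).div (by fun_prop) fun _ hw =>
      sub_ne_zero_of_im_neg (by simpa using hz) (le_of_lt hw))

theorem tendsto_mul_reflectedCauchyIntegrand_zero (hz : z ≠ 0)
    (hzero : Tendsto (fun w => w * f w) (𝓝[puncturedHalfPlane] 0) (𝓝 0)) :
    Tendsto (fun w => w * reflectedCauchyIntegrand f z w) (𝓝[puncturedHalfPlane] 0) (𝓝 0) := by
  have hid : Tendsto (fun w : ℂ => w) (𝓝[puncturedHalfPlane] 0) (𝓝 0) :=
    tendsto_id.mono_left nhdsWithin_le_nhds
  have h := ((hzero.sub (hid.mul_const (f z))).div (tendsto_sub_nhdsWithin_zero z)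
    (neg_ne_zero.2 hz)).add ((hid.mul_const (f z)).div (tendsto_sub_nhdsWithin_zero (conj z))
      (neg_ne_zero.2 (by simpa using hz)))
  simp only [zero_mul, sub_zero, zero_div, add_zero, Pi.div_apply] at h
  refine h.congr' ?_
  filter_upwards [nhdsWithin_le_nhds (eventually_ne_nhds hz.symm)] with w hw
  rw [reflectedCauchyIntegrand_of_ne hw]
  ring

theorem tendsto_mul_reflectedCauchyIntegrand_cobounded
    (hinfty : Tendsto f (cobounded ℂ ⊓ 𝓟 puncturedHalfPlane) (𝓝 0)) :
    Tendsto (fun w => w * reflectedCauchyIntegrand f z w)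
      (cobounded ℂ ⊓ 𝓟 puncturedHalfPlane) (𝓝 0) := by
  have h := ((hinfty.sub_const (f z)).mul
    ((tendsto_div_sub_cobounded z).mono_left inf_le_left)).add
    (((tendsto_div_sub_cobounded (conj z)).mono_left inf_le_left).const_mul (f z))
  rw [zero_sub, mul_one, mul_one, neg_add_cancel] at h
  refine h.congr' ?_
  filter_upwards [(eventually_ne_cobounded z).filter_mono inf_le_left] with w hw
  rw [reflectedCauchyIntegrand_of_ne hw]
  ring

theorem integral_div_sub_of_im_pos (hf : IsCauchyAdmissible f) (hz : 0 < z.im)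
    (hint : Integrable fun x : ℝ => f x / (x - z)) :
    ∫ x : ℝ, f x / (x - z) = 2 * Real.pi * Complex.I * f z := by
  have hkernel := (integrable_inv_sub_mul_sub_conj hz.ne').const_mul (2 * Complex.I * z.im * f z)
  have hcauchy : ∫ x : ℝ, reflectedCauchyIntegrand f z x = 0 := by
    refine integral_eq_zero_of_tendsto_smul_zero
      (continuousOn_reflectedCauchyIntegrand hz hf.continuousOn
        (hf.differentiableOn.differentiableAt (setOf_im_pos_mem_nhds hz)))
      (differentiableOn_reflectedCauchyIntegrand hz hf.differentiableOn)
      (tendsto_mul_reflectedCauchyIntegrand_zero (fun h => by simp [h] at hz) hf.tendsto_mul_zero)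
      (tendsto_mul_reflectedCauchyIntegrand_cobounded hf.tendsto_cobounded) ?_
    simp only [reflectedCauchyIntegrand_ofReal hz.ne']
    exact hint.sub hkernel
  simp only [reflectedCauchyIntegrand_ofReal hz.ne'] at hcauchy
  rw [integral_sub hint hkernel, integral_const_mul, integral_inv_sub_mul_sub_conj hz,
    sub_eq_zero] at hcauchy
  have him : (z.im : ℂ) ≠ 0 := by exact_mod_cast hz.ne'
  rw [hcauchy]
  field_simp

theorem integrable_div_sub_conj (hz : z.im ≠ 0) (hint : Integrable fun x : ℝ => f x / (x - z)) :
    Integrable fun x : ℝ => f x / (x - conj z) := by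
  have hne (x : ℝ) : (x : ℂ) - conj z ≠ 0 := ofReal_sub_ne_zero (by simpa using hz) x
  have hunit : Continuous fun x : ℝ => ((x : ℂ) - z) / (x - conj z) :=
    Continuous.div (by fun_prop) (by fun_prop) hne
  refine (hint.bdd_mul hunit.aestronglyMeasurable (c := 1) (ae_of_all _ fun x => ?_)).congr
    (ae_of_all _ fun x => ?_)
  · have hconj : (x : ℂ) - conj z = conj ((x : ℂ) - z) := by simp
    rw [norm_div, hconj, RCLike.norm_conj]
    exact div_self_le_one _
  · have := hne x
    have := ofReal_sub_ne_zero hz x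
    field_simp

/- On the real line `f - conj f = 2 i Im f`. The conjugate term contributes nothing because
`conj (f x) / (x - z)` is the conjugate of `f x / (x - conj z)`. -/
theorem integral_im_div_sub_of_im_pos (hf : IsCauchyAdmissible f) (hz : 0 < z.im)
    (hint : Integrable fun x : ℝ => f x / (x - z)) :
    Integrable (fun x : ℝ => ((f x).im : ℂ) / (x - z)) ∧
      ∫ x : ℝ, ((f x).im : ℂ) / (x - z) = Real.pi * f z := by
  have hintconj := integrable_div_sub_conj hz.ne' hint
  have him (x : ℝ) : ((f x).im : ℂ) / (x - z) =
      (2 * Complex.I)⁻¹ * (f x / (x - z) - conj (f x / (x - conj z))) := by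
    have hsub : ((f x).im : ℂ) = (f x - conj (f x)) / (2 * Complex.I) := by
      rw [Complex.sub_conj]
      field_simp
      push_cast
      ring
    simp only [hsub, map_div₀, map_sub, Complex.conj_ofReal, Complex.conj_conj]
    ring
  have hintconj' : Integrable fun x : ℝ => conj (f x / (x - conj z)) :=
    (Complex.conjCLE.toContinuousLinearMap).integrable_comp hintconj
  simp only [him]
  refine ⟨(hint.sub hintconj').const_mul _, ?_⟩
  rw [integral_const_mul, integral_sub hint hintconj', integral_conj,
    integral_div_sub_of_im_neg hf (by simpa using hz) hintconj,
    integral_div_sub_of_im_pos hf hz hint, map_zero]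
  have := Complex.I_ne_zero
  field_simp
  ring

theorem eq_integral_im_comp_neg_div_add (hf : IsCauchyAdmissible f) (hz : 0 < z.im)
    (hint : Integrable fun x : ℝ => f x / (x - z)) (hreal : ∀ x : ℝ, 0 < x → (f x).im = 0) :
    f z = ∫ t in Ioi (0 : ℝ), ((-(f (-t)).im / Real.pi : ℝ) : ℂ) / (t + z) := by
  obtain ⟨hint_im, hformula⟩ := integral_im_div_sub_of_im_pos hf hz hint
  have hpos : ∫ x in Ioi (0 : ℝ), ((f x).im : ℂ) / (x - z) = 0 :=
    setIntegral_eq_zero_of_forall_eq_zero fun x hx => by simp [hreal x hx]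
  rw [integral_eq_integral_Ioi_add_comp_neg hint_im, hpos, zero_add] at hformula
  have hpi : (Real.pi : ℂ) ≠ 0 := by exact_mod_cast Real.pi_ne_zero
  rw [← mul_right_inj' hpi, ← hformula, ← integral_const_mul]
  refine setIntegral_congr_fun measurableSet_Ioi fun t _ => ?_
  have hneg : (((-t : ℝ) : ℂ) - z) = -(t + z) := by push_cast; ring
  simp only [hneg]
  push_cast
  field_simp

end CauchyFormula

section Logarithm

theorem clog_ne_zero {u : ℂ} (h0 : u ≠ 0) (h1 : u ≠ 1) : Complex.log u ≠ 0 := fun h =>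
  h1 (by rw [← Complex.exp_log h0, h, Complex.exp_zero])

theorem abs_log_norm_le_norm_clog (u : ℂ) : |Real.log ‖u‖| ≤ ‖Complex.log u‖ := by
  rw [← Complex.log_re]
  exact Complex.abs_re_le_norm _

theorem tendsto_clog_nhdsNE_zero : Tendsto Complex.log (𝓝[≠] 0) (cobounded ℂ) :=
  tendsto_norm_atTop_iff_cobounded.1 <| tendsto_atTop_mono abs_log_norm_le_norm_clog <|
    tendsto_abs_atBot_atTop.comp (Real.tendsto_log_nhdsGT_zero.comp tendsto_norm_nhdsNE_zero)

theorem tendsto_clog_cobounded : Tendsto Complex.log (cobounded ℂ) (cobounded ℂ) :=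
  tendsto_norm_atTop_iff_cobounded.1 <| tendsto_atTop_mono abs_log_norm_le_norm_clog <|
    tendsto_abs_atTop_atTop.comp (Real.tendsto_log_atTop.comp tendsto_norm_cobounded_atTop)

theorem continuousAt_inv_clog_zero : ContinuousAt (fun u : ℂ => (Complex.log u)⁻¹) 0 := by
  rw [← continuousWithinAt_compl_self, ContinuousWithinAt, Complex.log_zero, inv_zero]
  exact tendsto_inv₀_cobounded.comp tendsto_clog_nhdsNE_zero

theorem isLittleO_one_rpow_norm_nhdsNE_zero {r : ℝ} (hr : r < 0) :
    (fun _ => (1 : ℝ)) =o[𝓝[≠] (0 : ℂ)] fun w => ‖w‖ ^ r :=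
  isLittleO_const_left.2 <| Or.inr <| tendsto_norm_atTop_atTop.comp <|
    (tendsto_rpow_neg_nhdsGT_zero hr).comp tendsto_norm_nhdsNE_zero

theorem isLittleO_clog_rpow_nhdsNE_zero {r : ℝ} (hr : r < 0) :
    Complex.log =o[𝓝[≠] 0] fun w => ‖w‖ ^ r := by
  have harg : (fun w : ℂ => (w.arg : ℂ) * Complex.I) =O[𝓝[≠] 0] fun _ => (1 : ℝ) :=
    IsBigO.of_bound Real.pi (Eventually.of_forall fun w => by
      simpa using Complex.abs_arg_le_pi w)
  have hre : (fun w : ℂ => (Real.log ‖w‖ : ℂ)) =o[𝓝[≠] 0] fun w => ‖w‖ ^ r :=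
    IsLittleO.of_norm_left <| by
      simpa [Function.comp_def] using
        ((isLittleO_log_rpow_nhdsGT_zero hr).comp_tendsto tendsto_norm_nhdsNE_zero).norm_left
  exact hre.add (harg.trans_isLittleO (isLittleO_one_rpow_norm_nhdsNE_zero hr))

theorem isEquivalent_clog_one_add_zero : (fun w : ℂ => Complex.log (1 + w)) ~[𝓝 0] id :=
  Complex.log_sub_self_isBigO.trans_isLittleO (isLittleO_pow_id one_lt_two)

theorem isBigO_clog_one_add_inv_sub_inv :
    (fun w : ℂ => Complex.log (1 + w⁻¹) - w⁻¹) =O[cobounded ℂ] fun w => w⁻¹ ^ 2 :=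
  Complex.log_sub_self_isBigO.comp_tendsto tendsto_inv₀_cobounded

theorem isBigO_clog_one_add_inv :
    (fun w : ℂ => Complex.log (1 + w⁻¹)) =O[cobounded ℂ] fun w => w⁻¹ :=
  isEquivalent_clog_one_add_zero.isBigO.comp_tendsto tendsto_inv₀_cobounded

theorem continuousWithinAt_clog {w : ℂ} (hw : w ∈ puncturedHalfPlane) :
    ContinuousWithinAt Complex.log {w | 0 ≤ w.im} w := by
  by_cases h : w ∈ Complex.slitPlane
  · exact (continuousAt_clog h).continuousWithinAt
  · rw [Complex.mem_slitPlane_iff, not_or, not_lt, not_not] at h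
    exact Complex.continuousWithinAt_log_of_re_neg_of_im_zero
      (h.1.lt_of_ne fun h0 => hw.2 (Complex.ext h0 h.2)) h.2

theorem one_add_mem_slitPlane {w : ℂ} (hw : w ∈ Complex.slitPlane) :
    1 + w ∈ Complex.slitPlane := by
  rw [Complex.mem_slitPlane_iff] at *
  simp only [Complex.add_re, Complex.one_re, Complex.add_im, Complex.one_im, zero_add]
  exact hw.imp_left fun h => by linarith

theorem clog_neg_ofReal {x : ℝ} (hx : 0 < x) :
    Complex.log (-x) = Real.log x + Real.pi * Complex.I := by
  have := Complex.log_ofReal_mul hx (x := -1) (by norm_num)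
  rwa [Complex.log_neg_one, mul_neg_one] at this

/- Both `w` and `1 + w⁻¹` keep their arguments in `[0, π]` and `[-π / 2, 0]`, so the principal
branch is additive on their product `1 + w`. -/
theorem clog_one_add_eq_add {w : ℂ} (hw : w ∈ puncturedHalfPlane) (h : 1 < ‖w‖) :
    Complex.log (1 + w) = Complex.log w + Complex.log (1 + w⁻¹) := by
  have hre : 0 < (1 + w⁻¹).re := by
    have hinv : ‖w⁻¹‖ < 1 := by rw [norm_inv]; exact inv_lt_one_of_one_lt₀ h
    have := (abs_lt.1 ((Complex.abs_re_le_norm w⁻¹).trans_lt hinv)).1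
    simp only [Complex.add_re, Complex.one_re]
    linarith
  have him : (1 + w⁻¹).im ≤ 0 := by
    simp only [Complex.add_im, Complex.one_im, zero_add, Complex.inv_im]
    exact div_nonpos_of_nonpos_of_nonneg (neg_nonpos.2 hw.1) (Complex.normSq_nonneg _)
  have hne : 1 + w⁻¹ ≠ 0 := fun h0 => by simp [h0] at hre
  have hfactor : 1 + w = w * (1 + w⁻¹) := by
    rw [mul_add, mul_one, mul_inv_cancel₀ hw.2, add_comm]
  have harg_nonneg : 0 ≤ w.arg := Complex.arg_nonneg_iff.2 hw.1
  have harg_ge : -(Real.pi / 2) ≤ (1 + w⁻¹).arg :=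
    Complex.neg_pi_div_two_le_arg_iff.2 (Or.inl hre.le)
  have harg_nonpos : (1 + w⁻¹).arg ≤ 0 := by
    rcases him.lt_or_eq with h | h
    · exact (Complex.arg_neg_iff.2 h).le
    · exact (Complex.arg_eq_zero_iff.2 ⟨hre.le, h⟩).le
  rw [hfactor]
  exact Complex.log_mul hw.2 hne
    ⟨by linarith [Real.pi_pos], by linarith [Complex.arg_le_pi w]⟩

end Logarithm

section RegularityOfG

theorem differentiableAt_G {w : ℂ} (hw : w ∈ Complex.slitPlane) : DifferentiableAt ℂ G w := by
  have hadd := one_add_mem_slitPlane hw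
  have hlog : Complex.log (1 + w) ≠ 0 := clog_ne_zero (Complex.slitPlane_ne_zero hadd)
    (by simpa using Complex.slitPlane_ne_zero hw)
  have hdiff := Complex.differentiableAt_log hw
  have hdiff_add : DifferentiableAt ℂ (fun w => Complex.log (1 + w)) w :=
    (differentiableAt_id.const_add 1).clog hadd
  exact (((hdiff.div hdiff_add hlog).const_sub 1).mul differentiableAt_id).mul hdiff

theorem continuousOn_G : ContinuousOn G puncturedHalfPlane := by
  intro w hw
  have hlog : ContinuousWithinAt Complex.log puncturedHalfPlane w :=
    (continuousWithinAt_clog hw).mono fun x hx => hx.1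
  have hadd : ContinuousWithinAt (fun w : ℂ => 1 + w) puncturedHalfPlane w := by fun_prop
  have hinv : ContinuousWithinAt (fun w => (Complex.log (1 + w))⁻¹) puncturedHalfPlane w := by
    by_cases h0 : 1 + w = 0
    · exact ContinuousAt.comp_continuousWithinAt (g := fun u : ℂ => (Complex.log u)⁻¹)
        (h0 ▸ continuousAt_inv_clog_zero) hadd
    · have hmem : 1 + w ∈ puncturedHalfPlane := ⟨by simpa using hw.1, h0⟩
      refine ((continuousWithinAt_clog hmem).comp hadd fun x hx => ?_).inv₀
        (clog_ne_zero h0 (by simpa using hw.2))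
      simpa using hx.1
  exact ((continuousWithinAt_const.sub (hlog.mul hinv)).mul continuousWithinAt_id).mul hlog

theorem isBigO_one_sub_G_zero :
    (fun w => 1 - G w) =O[𝓝[≠] 0] fun w => ‖w‖ ^ (-(1 / 2) : ℝ) := by
  have hlog : Complex.log =O[𝓝[≠] 0] fun w => ‖w‖ ^ (-(1 / 4) : ℝ) :=
    (isLittleO_clog_rpow_nhdsNE_zero (by norm_num)).isBigO
  have hne : ∀ᶠ w : ℂ in 𝓝[≠] 0, Complex.log (1 + w) ≠ 0 := by
    filter_upwards [self_mem_nhdsWithin, nhdsWithin_le_nhds (eventually_ne_nhds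
      (neg_ne_zero.2 one_ne_zero).symm)] with w hw hw'
    exact clog_ne_zero (fun h => hw' (eq_neg_of_add_eq_zero_right h)) (by simpa using hw)
  have hratio : Tendsto (fun w => w / Complex.log (1 + w)) (𝓝[≠] 0) (𝓝 1) :=
    (isEquivalent_iff_tendsto_one hne).1
      (isEquivalent_clog_one_add_zero.mono nhdsWithin_le_nhds).symm
  have hlog_add : Tendsto (fun w => Complex.log (1 + w)) (𝓝[≠] 0) (𝓝 0) := by
    simpa using (isEquivalent_clog_one_add_zero.symm.tendsto_nhds tendsto_id).mono_left
      nhdsWithin_le_nhds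
  have hone : (fun _ => (1 : ℝ)) =O[𝓝[≠] (0 : ℂ)] fun w => ‖w‖ ^ (-(1 / 4) : ℝ) :=
    (isLittleO_one_rpow_norm_nhdsNE_zero (by norm_num)).isBigO
  have hprod := (((hlog_add.isBigO_one ℝ).trans hone).sub hlog).mul
    ((hratio.isBigO_one ℝ).mul hlog)
  have hpow : (fun w : ℂ => ‖w‖ ^ (-(1 / 4) : ℝ) * (1 * ‖w‖ ^ (-(1 / 4) : ℝ))) =ᶠ[𝓝[≠] 0]
      fun w => ‖w‖ ^ (-(1 / 2) : ℝ) := by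
    filter_upwards [self_mem_nhdsWithin] with w hw
    rw [one_mul, ← Real.rpow_add (norm_pos_iff.2 hw)]
    norm_num
  have hone_half : (fun _ => (1 : ℂ)) =O[𝓝[≠] (0 : ℂ)] fun w => ‖w‖ ^ (-(1 / 2) : ℝ) :=
    (isBigO_const_const (1 : ℂ) one_ne_zero _).trans
      (isLittleO_one_rpow_norm_nhdsNE_zero (by norm_num)).isBigO
  refine (hone_half.sub (hprod.trans_eventuallyEq hpow)).congr' ?_ EventuallyEq.rfl
  filter_upwards [hne] with w hw
  rw [G]
  field_simp

theorem one_sub_G_eq_of_one_lt_norm {w : ℂ} (hw : w ∈ puncturedHalfPlane) (h : 1 < ‖w‖) :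
    1 - G w = -(w * (Complex.log (1 + w⁻¹) - w⁻¹)) +
      w * Complex.log (1 + w⁻¹) ^ 2 * (Complex.log (1 + w))⁻¹ := by
  have hw0 := hw.2
  have hne : Complex.log (1 + w) ≠ 0 := by
    refine clog_ne_zero (fun h0 => ?_) (by simpa using hw0)
    rw [eq_neg_of_add_eq_zero_right h0] at h
    simp at h
  rw [G, eq_sub_of_add_eq (clog_one_add_eq_add hw h).symm]
  generalize Complex.log (1 + w) = l at *
  field_simp
  ring

theorem isBigO_one_sub_G_cobounded :
    (fun w => 1 - G w) =O[cobounded ℂ ⊓ 𝓟 puncturedHalfPlane] fun w => w⁻¹ := by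
  have hinv_log : (fun w : ℂ => (Complex.log (1 + w))⁻¹) =O[cobounded ℂ] fun _ => (1 : ℂ) :=
    (tendsto_inv₀_cobounded.comp (tendsto_clog_cobounded.comp
      (tendsto_const_add_cobounded 1))).isBigO_one ℂ
  have hid := isBigO_refl (fun w : ℂ => w) (cobounded ℂ)
  have hsum := (hid.mul isBigO_clog_one_add_inv_sub_inv).neg_left.add
    (((hid.mul (isBigO_clog_one_add_inv.pow 2)).mul hinv_log).congr_right fun w => mul_one _)
  refine (hsum.mono inf_le_left).congr' ?_ ?_
  · filter_upwards [mem_inf_of_right (mem_principal_self _),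
      (tendsto_norm_cobounded_atTop.eventually_gt_atTop 1).filter_mono inf_le_left] with w hw h
    exact (one_sub_G_eq_of_one_lt_norm hw h).symm
  · filter_upwards [(eventually_ne_cobounded 0).filter_mono inf_le_left] with w hw
    field_simp

theorem tendsto_mul_one_sub_G_zero : Tendsto (fun w => w * (1 - G w)) (𝓝[≠] 0) (𝓝 0) := by
  have hpow : Tendsto (fun w : ℂ => ‖w‖ ^ (1 / 2 : ℝ)) (𝓝[≠] 0) (𝓝 0) := by
    have h := (Real.continuous_rpow_const (q := 1 / 2) (by norm_num)).comp
      (continuous_norm (E := ℂ))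
    simpa [Function.comp_def] using (h.tendsto 0).mono_left nhdsWithin_le_nhds
  refine IsBigO.trans_tendsto ?_ hpow
  refine ((isBigO_refl (fun w : ℂ => w) (𝓝[≠] 0)).norm_right.mul
    isBigO_one_sub_G_zero).congr_right fun w => ?_
  change ‖w‖ * ‖w‖ ^ (-(1 / 2) : ℝ) = ‖w‖ ^ (1 / 2 : ℝ)
  rw [← Real.rpow_one_add' (norm_nonneg w) (by norm_num)]
  norm_num

theorem isCauchyAdmissible_one_sub_G : IsCauchyAdmissible fun w => 1 - G w where
  continuousOn := continuousOn_const.sub continuousOn_G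
  differentiableOn _ hw :=
    ((differentiableAt_G (Or.inr (ne_of_gt hw))).const_sub 1).differentiableWithinAt
  tendsto_mul_zero := tendsto_mul_one_sub_G_zero.mono_left (nhdsWithin_mono 0 fun _ hw => hw.2)
  tendsto_cobounded :=
    isBigO_one_sub_G_cobounded.trans_tendsto (tendsto_inv₀_cobounded.mono_left inf_le_left)

end RegularityOfG

section Integrability

variable {E : Type*} [NormedAddCommGroup E] {r : ℝ}

theorem integrableAtFilter_rpow_nhdsGT_zero (hr : -1 < r) :
    IntegrableAtFilter (fun x : ℝ => x ^ r) (𝓝[>] 0) :=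
  ⟨Ioo 0 1, Ioo_mem_nhdsGT zero_lt_one,
    (intervalIntegral.integrableOn_Ioo_rpow_iff zero_lt_one).2 hr⟩

theorem integrableOn_Ioi_of_isBigO {f : ℝ → E} {g : ℝ → ℝ} (hf : ContinuousOn f (Ioi 0))
    (hr : -1 < r) (hzero : f =O[𝓝[>] 0] fun x => x ^ r) (htop : f =O[atTop] g)
    (hg : IntegrableAtFilter g atTop) : IntegrableOn f (Ioi 0) := by
  have hmeas : AEStronglyMeasurable f (volume.restrict (Ioi 0)) :=
    hf.aestronglyMeasurable measurableSet_Ioi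
  exact integrableOn_Ioi_iff_integrableAtFilter_atTop_nhdsWithin.2
    ⟨htop.integrableAtFilter ⟨Ioi 0, Ioi_mem_atTop 0, hmeas⟩ hg,
      hzero.integrableAtFilter ⟨Ioi 0, self_mem_nhdsWithin, hmeas⟩
        (integrableAtFilter_rpow_nhdsGT_zero hr),
      hf.locallyIntegrableOn measurableSet_Ioi⟩

theorem tendsto_neg_nhdsGT_zero : Tendsto (fun x : ℝ => -x) (𝓝[>] 0) (𝓝[≠] 0) := by
  refine tendsto_nhdsWithin_iff.2 ⟨?_, ?_⟩
  · simpa using (continuous_neg.tendsto (0 : ℝ)).mono_left nhdsWithin_le_nhds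
  · filter_upwards [self_mem_nhdsWithin] with x hx
    exact neg_ne_zero.2 (ne_of_gt hx)

theorem integrable_of_isBigO_abs_rpow {f : ℝ → E} {s : ℝ} (hf : ContinuousOn f {0}ᶜ)
    (hr : -1 < r) (hs : s < -1) (hzero : f =O[𝓝[≠] 0] fun x => |x| ^ r)
    (hinfty : f =O[cobounded ℝ] fun x => |x| ^ s) : Integrable f := by
  rw [IsOrderBornology.cobounded_eq, isBigO_sup] at hinfty
  have abs_rpow_nhdsGT : (fun x : ℝ => |x| ^ r) =ᶠ[𝓝[>] 0] fun x => x ^ r := by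
    filter_upwards [self_mem_nhdsWithin] with x hx
    rw [abs_of_pos hx]
  have abs_rpow_atTop : (fun x : ℝ => |x| ^ s) =ᶠ[atTop] fun x => x ^ s := by
    filter_upwards [eventually_gt_atTop 0] with x hx
    rw [abs_of_pos hx]
  have htail := integrableAtFilter_rpow_atTop_iff.2 hs
  refine integrable_iff_integrableOn_Ioi_comp_neg.2 ⟨?_, ?_⟩
  · exact integrableOn_Ioi_of_isBigO (hf.mono fun x hx => ne_of_gt hx) hr
      ((hzero.mono (nhdsWithin_mono 0 fun x hx => ne_of_gt hx)).trans_eventuallyEq abs_rpow_nhdsGT)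
      (hinfty.2.trans_eventuallyEq abs_rpow_atTop) htail
  · refine integrableOn_Ioi_of_isBigO
      (hf.comp continuousOn_neg fun x hx => neg_ne_zero.2 (ne_of_gt hx)) hr ?_ ?_ htail
    · refine IsBigO.trans_eventuallyEq ?_ abs_rpow_nhdsGT
      simpa [Function.comp_def] using hzero.comp_tendsto tendsto_neg_nhdsGT_zero
    · refine IsBigO.trans_eventuallyEq ?_ abs_rpow_atTop
      simpa [Function.comp_def] using hinfty.1.comp_tendsto tendsto_neg_atTop_atBot

theorem tendsto_ofReal_cobounded : Tendsto Complex.ofReal (cobounded ℝ)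
    (cobounded ℂ ⊓ 𝓟 puncturedHalfPlane) := by
  refine tendsto_inf.2 ⟨?_, tendsto_principal.2 ?_⟩
  · exact Complex.isometry_ofReal.antilipschitz.tendsto_cobounded
  · filter_upwards [eventually_ne_cobounded 0] with x hx
    exact ofReal_mem_puncturedHalfPlane hx

theorem tendsto_ofReal_nhdsNE_zero : Tendsto Complex.ofReal (𝓝[≠] 0) (𝓝[≠] 0) := by
  simpa using Complex.continuous_ofReal.continuousWithinAt.tendsto_nhdsWithin
    (x := 0) (s := {0}ᶜ) (t := {0}ᶜ) fun x hx => by simpa using hx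

theorem integrable_one_sub_G_div_sub {z : ℂ} (hz : 0 < z.im) :
    Integrable fun x : ℝ => (1 - G x) / (x - z) := by
  have hsub (x : ℝ) : (x : ℂ) - z ≠ 0 := ofReal_sub_ne_zero hz.ne' x
  have hcont : ContinuousOn (fun x : ℝ => (1 - G x) / (x - z)) {0}ᶜ :=
    (continuousOn_const.sub (continuousOn_G.comp Complex.continuous_ofReal.continuousOn
      fun x hx => ofReal_mem_puncturedHalfPlane hx)).div (by fun_prop) fun x _ => hsub x
  have hinv_zero : (fun x : ℝ => ((x : ℂ) - z)⁻¹) =O[𝓝[≠] 0] fun _ => (1 : ℝ) := by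
    have hinv : Continuous fun x : ℝ => ((x : ℂ) - z)⁻¹ :=
      Continuous.inv₀ (by fun_prop) hsub
    exact ((hinv.tendsto 0).mono_left nhdsWithin_le_nhds).isBigO_one ℝ
  have hinv_infty : (fun x : ℝ => ((x : ℂ) - z)⁻¹) =O[cobounded ℝ] fun x => (x : ℂ)⁻¹ := by
    have hratio := (((tendsto_div_sub_cobounded z).mono_left inf_le_left).comp
      tendsto_ofReal_cobounded).isBigO_one ℂ
    refine ((isBigO_refl (fun x : ℝ => (x : ℂ)⁻¹) (cobounded ℝ)).mul hratio).congr' ?_ (by simp)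
    filter_upwards [eventually_ne_cobounded 0] with x hx
    have : (x : ℂ) ≠ 0 := by exact_mod_cast hx
    simp only [Function.comp_apply]
    field_simp
  refine integrable_of_isBigO_abs_rpow (r := -(1 / 2)) (s := -2) hcont (by norm_num)
    (by norm_num) ?_ ?_
  · simpa [Function.comp_def, div_eq_mul_inv] using
      (isBigO_one_sub_G_zero.comp_tendsto tendsto_ofReal_nhdsNE_zero).mul hinv_zero
  · refine ((isBigO_one_sub_G_cobounded.comp_tendsto tendsto_ofReal_cobounded).mul
      hinv_infty).norm_right.congr_right fun x => ?_
    have hsq : |x| ^ (-2 : ℝ) = (|x| ^ 2)⁻¹ := by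
      rw [Real.rpow_neg (abs_nonneg x), Real.rpow_two]
    simp only [Function.comp_apply, ← sq, norm_pow, norm_inv, Complex.norm_real,
      Real.norm_eq_abs, inv_pow, hsq]

end Integrability

section BoundaryValues

theorem G_ofReal {x : ℝ} (hx : 0 < x) :
    G x = (((1 - Real.log x / Real.log (1 + x)) * x * Real.log x : ℝ) : ℂ) := by
  have hlog : Complex.log (1 + x) = (Real.log (1 + x) : ℂ) := by
    rw [Complex.ofReal_log (by linarith), Complex.ofReal_add, Complex.ofReal_one]
  rw [G, hlog, ← Complex.ofReal_log hx.le]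
  push_cast
  rfl

theorem im_G_neg_of_lt_one {t : ℝ} (ht : 0 < t) (h : t < 1) :
    (G (-t)).im = Real.pi * rho t := by
  have hlog : Complex.log (1 + -t) = (Real.log (1 - t) : ℂ) := by
    rw [Complex.ofReal_log (by linarith), ← sub_eq_add_neg, Complex.ofReal_sub,
      Complex.ofReal_one]
  have hlog_div : Real.log ((1 - t) / t ^ 2) = Real.log (1 - t) - 2 * Real.log t := by
    rw [Real.log_div (by linarith) (by positivity), Real.log_pow, Nat.cast_ofNat]
  have hlog_ne : Real.log (1 - t) ≠ 0 := (Real.log_neg (by linarith) (by linarith)).ne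
  have hre_im : G (-t) =
      ((-t * (Real.log t - (Real.log t ^ 2 - Real.pi ^ 2) / Real.log (1 - t)) : ℝ) : ℂ) +
        ((-t * Real.pi * (1 - 2 * Real.log t / Real.log (1 - t)) : ℝ) : ℂ) * Complex.I := by
    have : (Real.log (1 - t) : ℂ) ≠ 0 := by exact_mod_cast hlog_ne
    rw [G, hlog, clog_neg_ofReal ht]
    push_cast
    field_simp
    linear_combination (Real.pi ^ 2 : ℂ) * Complex.I_sq
  rw [hre_im, Complex.add_im, Complex.ofReal_im, Complex.im_ofReal_mul, Complex.I_im, zero_add,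
    rho, if_pos h, hlog_div]
  field_simp

theorem im_G_neg_of_one_lt {t : ℝ} (h : 1 < t) : (G (-t)).im = Real.pi * rho t := by
  have hlog : Complex.log (1 + -t) = Real.log (t - 1) + Real.pi * Complex.I := by
    rw [← clog_neg_ofReal (sub_pos.2 h)]
    push_cast
    ring_nf
  have hlog_div : Real.log ((t - 1) / t) = Real.log (t - 1) - Real.log t :=
    Real.log_div (by linarith) (by linarith)
  rw [G, hlog, clog_neg_ofReal (by linarith), rho, if_neg (by linarith), if_neg h.ne', hlog_div]
  generalize Real.log (t - 1) = m
  generalize Real.log t = l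
  have hden : m ^ 2 + Real.pi ^ 2 ≠ 0 := by positivity
  have hden' : (m : ℂ) ^ 2 + (Real.pi : ℂ) ^ 2 ≠ 0 := by exact_mod_cast hden
  have hne : (m : ℂ) + Real.pi * Complex.I ≠ 0 := fun h0 => by
    simpa using congrArg Complex.im h0
  have hre_im : (1 - ((l : ℂ) + Real.pi * Complex.I) / (m + Real.pi * Complex.I)) * -(t : ℂ) *
        (l + Real.pi * Complex.I) =
      ((-t * (m - l) * (l * m + Real.pi ^ 2) / (m ^ 2 + Real.pi ^ 2) : ℝ) : ℂ) +
        ((-t * Real.pi * (m - l) ^ 2 / (m ^ 2 + Real.pi ^ 2) : ℝ) : ℂ) * Complex.I := by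
    push_cast
    field_simp
    ring_nf
    simp only [Complex.I_sq]
    ring
  rw [hre_im, Complex.add_im, Complex.ofReal_im, Complex.im_ofReal_mul, Complex.I_im, zero_add]
  field_simp

theorem im_G_neg {t : ℝ} (ht : 0 < t) : (G (-t)).im = Real.pi * rho t := by
  rcases lt_trichotomy t 1 with h | rfl | h
  · exact im_G_neg_of_lt_one ht h
  · simp [rho, G, Complex.log_neg_one]
  · exact im_G_neg_of_one_lt h

theorem rho_eq_im_G_neg_div_pi {t : ℝ} (ht : 0 < t) : rho t = (G (-t)).im / Real.pi := by
  rw [im_G_neg ht, mul_div_cancel_left₀ _ Real.pi_ne_zero]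

theorem continuousOn_rho : ContinuousOn rho (Ioi 0) := by
  have h : ContinuousOn (fun t : ℝ => (G (-t : ℝ)).im / Real.pi) (Ioi 0) :=
    (Complex.continuous_im.comp_continuousOn (continuousOn_G.comp (by fun_prop) fun t ht =>
      ofReal_mem_puncturedHalfPlane (neg_ne_zero.2 (ne_of_gt ht)))).div_const _
  exact h.congr fun t ht => by simp [rho_eq_im_G_neg_div_pi ht]

theorem isBigO_rho_zero : rho =O[𝓝[>] 0] fun t => t ^ (-(1 / 2) : ℝ) := by
  have htendsto : Tendsto (fun t : ℝ => -(t : ℂ)) (𝓝[>] 0) (𝓝[≠] 0) := by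
    simpa [Function.comp_def] using tendsto_ofReal_nhdsNE_zero.comp tendsto_neg_nhdsGT_zero
  have him : (fun t : ℝ => (1 - G (-t)).im) =O[𝓝[>] 0] fun t : ℝ => 1 - G (-t) :=
    isBigO_of_le _ fun t => Complex.abs_im_le_norm _
  refine ((him.trans (isBigO_one_sub_G_zero.comp_tendsto htendsto)).const_mul_left
    (-Real.pi⁻¹)).congr' ?_ ?_
  · filter_upwards [self_mem_nhdsWithin] with t ht
    rw [rho_eq_im_G_neg_div_pi ht, Complex.sub_im, Complex.one_im]
    ring
  · filter_upwards [self_mem_nhdsWithin] with t ht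
    simp [abs_of_pos (mem_Ioi.1 ht)]

theorem abs_log_sub_one_div_le {t : ℝ} (ht : 1 < t) :
    |Real.log ((t - 1) / t)| ≤ (t - 1)⁻¹ := by
  have hpos : 0 < (t - 1) / t := div_pos (by linarith) (by linarith)
  rw [abs_of_nonpos (Real.log_nonpos hpos.le ((div_le_one (by linarith)).2 (by linarith)))]
  have hlog := Real.one_sub_inv_le_log_of_pos hpos
  have : t - 1 ≠ 0 := by linarith
  have hone : 1 - ((t - 1) / t)⁻¹ = -(t - 1)⁻¹ := by
    field_simp
    ring
  linarith

theorem isBigO_rho_atTop : rho =O[atTop] fun t => t⁻¹ / Real.log t ^ 2 := by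
  refine IsBigO.of_bound 16 ?_
  filter_upwards [eventually_ge_atTop 3] with t ht
  have hlog : 0 < Real.log t := Real.log_pos (by linarith)
  have hlog_le : Real.log t ≤ 2 * Real.log (t - 1) := by
    rw [← Nat.cast_two, ← Real.log_pow]
    exact Real.log_le_log (by linarith) (by nlinarith)
  have hinv_le : (t - 1)⁻¹ ≤ 2 * t⁻¹ := by
    rw [← div_eq_mul_inv, inv_le_comm₀ (by linarith) (by positivity), inv_div]
    linarith
  have hnum : Real.log ((t - 1) / t) ^ 2 ≤ (2 * t⁻¹) ^ 2 :=
    sq_le_sq' (by linarith [neg_abs_le (Real.log ((t - 1) / t)),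
      abs_log_sub_one_div_le (t := t) (by linarith)]) ((le_abs_self _).trans
        ((abs_log_sub_one_div_le (by linarith)).trans hinv_le))
  have hden : Real.log t ^ 2 / 4 ≤ Real.log (t - 1) ^ 2 + Real.pi ^ 2 := by
    nlinarith [sq_nonneg Real.pi]
  rw [rho, if_neg (by linarith), if_neg (by linarith), norm_neg,
    Real.norm_of_nonneg (by positivity), Real.norm_of_nonneg (by positivity)]
  calc t * Real.log ((t - 1) / t) ^ 2 / (Real.log (t - 1) ^ 2 + Real.pi ^ 2)
      ≤ t * (2 * t⁻¹) ^ 2 / (Real.log t ^ 2 / 4) := by gcongr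
    _ = 16 * (t⁻¹ / Real.log t ^ 2) := by field_simp; norm_num

theorem integrableOn_rho : IntegrableOn rho (Ioi 0) :=
  integrableOn_Ioi_of_isBigO continuousOn_rho (by norm_num) isBigO_rho_zero isBigO_rho_atTop
    ⟨Ioi 2, Ioi_mem_atTop 2, integrableOn_inv_div_log_sq_Ioi one_lt_two⟩

end BoundaryValues

theorem one_sub_G_eq_stieltjes_of_im_pos {z : ℂ} (hz : 0 < z.im) :
    1 - G z = ∫ t in Ioi (0 : ℝ), (rho t : ℂ) / (t + z) := by
  rw [eq_integral_im_comp_neg_div_add isCauchyAdmissible_one_sub_G hz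
    (integrable_one_sub_G_div_sub hz) fun x hx => by simp [G_ofReal hx]]
  refine setIntegral_congr_fun measurableSet_Ioi fun t ht => ?_
  simp only [rho_eq_im_G_neg_div_pi ht, Complex.sub_im, Complex.one_im, zero_sub, neg_neg]

section LaplaceTransform

variable {g : ℝ → ℝ}

theorem integrableOn_exp_neg_mul_mul (hg : IntegrableOn g (Ioi 0)) {s : ℝ} (hs : 0 ≤ s) :
    IntegrableOn (fun t : ℝ => Real.exp (-s * t) * g t) (Ioi 0) := by
  refine Integrable.bdd_mul (c := 1) hg (Continuous.aestronglyMeasurable (by fun_prop)) ?_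
  filter_upwards [ae_restrict_mem measurableSet_Ioi] with t ht
  rw [Real.norm_of_nonneg (Real.exp_pos _).le, Real.exp_le_one_iff, neg_mul, neg_nonpos]
  exact mul_nonneg hs (le_of_lt ht)

theorem integrable_exp_neg_mul_mul_exp_neg_mul_mul (hg : IntegrableOn g (Ioi 0)) {z : ℂ}
    (hz : 0 < z.re) :
    Integrable (Function.uncurry fun s t : ℝ =>
      Complex.exp (-z * s) * ((Real.exp (-s * t) * g t : ℝ) : ℂ))
      ((volume.restrict (Ioi 0)).prod (volume.restrict (Ioi 0))) := by
  have hexp : IntegrableOn (fun s : ℝ => Complex.exp (-z * s)) (Ioi 0) :=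
    integrableOn_exp_mul_complex_Ioi (by simpa using hz) 0
  refine ((hexp.mul_prod hg.ofReal).bdd_mul (c := 1)
    (f := fun p => ((Real.exp (-p.1 * p.2) : ℝ) : ℂ))
    (Continuous.aestronglyMeasurable (by fun_prop)) ?_).congr (ae_of_all _ fun p => ?_)
  · rw [Measure.prod_restrict]
    filter_upwards [ae_restrict_mem (measurableSet_Ioi.prod measurableSet_Ioi)] with p hp
    rw [Complex.norm_real, Real.norm_of_nonneg (Real.exp_pos _).le, Real.exp_le_one_iff,
      neg_mul, neg_nonpos]
    exact mul_nonneg (le_of_lt hp.1) (le_of_lt hp.2)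
  · simp only [Function.uncurry, RCLike.ofReal_eq_complex_ofReal]
    push_cast
    ring

theorem integrableOn_exp_neg_mul_mul_laplace (hg : IntegrableOn g (Ioi 0)) {z : ℂ}
    (hz : 0 < z.re) :
    IntegrableOn (fun s : ℝ =>
      Complex.exp (-z * s) * ((∫ t in Ioi (0 : ℝ), Real.exp (-s * t) * g t : ℝ) : ℂ))
      (Ioi 0) := by
  have h := (integrable_exp_neg_mul_mul_exp_neg_mul_mul hg hz).integral_prod_left
  simp only [Function.uncurry, integral_const_mul, integral_complex_ofReal] at h
  exact h

theorem integral_exp_neg_mul_mul_laplace (hg : IntegrableOn g (Ioi 0)) {z : ℂ} (hz : 0 < z.re) :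
    ∫ s in Ioi (0 : ℝ), Complex.exp (-z * s) *
        ((∫ t in Ioi (0 : ℝ), Real.exp (-s * t) * g t : ℝ) : ℂ) =
      ∫ t in Ioi (0 : ℝ), (g t : ℂ) / (t + z) := by
  simp only [← integral_complex_ofReal, ← integral_const_mul]
  rw [integral_integral_swap (integrable_exp_neg_mul_mul_exp_neg_mul_mul hg hz)]
  refine setIntegral_congr_fun measurableSet_Ioi fun t ht => ?_
  have hre : (-(t + z)).re < 0 := by
    simp only [Complex.neg_re, Complex.add_re, Complex.ofReal_re]
    linarith [mem_Ioi.1 ht]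
  have hexp (s : ℝ) : Complex.exp (-z * s) * ((Real.exp (-s * t) * g t : ℝ) : ℂ) =
      Complex.exp (-(t + z) * s) * g t := by
    push_cast
    rw [← mul_assoc, ← Complex.exp_add]
    ring_nf
  simp only [hexp]
  rw [integral_mul_const, integral_exp_mul_complex_Ioi hre 0, Complex.ofReal_zero, mul_zero,
    Complex.exp_zero, neg_div_neg_eq, one_div_mul_eq_div]

theorem tendsto_mul_integral_div_add_atTop (hg : IntegrableOn g (Ioi 0)) :
    Tendsto (fun a : ℝ => a * ∫ t in Ioi (0 : ℝ), g t / (t + a)) atTop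
      (𝓝 (∫ t in Ioi (0 : ℝ), g t)) := by
  have hkernel (t : ℝ) : Tendsto (fun a : ℝ => a / (t + a)) atTop (𝓝 1) := by
    have h : Tendsto (fun a : ℝ => 1 - t / (t + a)) atTop (𝓝 (1 - 0)) :=
      tendsto_const_nhds.sub (tendsto_const_nhds.div_atTop
        (tendsto_atTop_add_const_left _ _ tendsto_id))
    rw [sub_zero] at h
    refine h.congr' ?_
    filter_upwards [eventually_gt_atTop (-t)] with a ha
    have : t + a ≠ 0 := by linarith
    field_simp
    ring
  simp only [← integral_const_mul]
  refine tendsto_integral_filter_of_dominated_convergence (fun t => ‖g t‖) ?_ ?_ hg.norm ?_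
  · exact Eventually.of_forall fun a => (hg.aestronglyMeasurable.mul
      (by fun_prop : Measurable fun t : ℝ => (t + a)⁻¹).aestronglyMeasurable).const_mul a
  · filter_upwards [eventually_ge_atTop (0 : ℝ)] with a ha
    filter_upwards [ae_restrict_mem measurableSet_Ioi] with t ht
    have ht' : 0 < t := ht
    rw [← mul_div_assoc, mul_div_right_comm, norm_mul, Real.norm_of_nonneg (by positivity)]
    exact mul_le_of_le_one_left (norm_nonneg _) ((div_le_one (by linarith)).2 (by linarith))
  · refine ae_of_all _ fun t => ?_
    simpa only [one_mul, mul_div_right_comm, ← mul_div_assoc] using (hkernel t).mul_const (g t)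

/- On both sides of `c`, `e^{s (c - t)} g t ≥ g t`. -/
theorem laplace_nonneg_of_sign_change (hg : IntegrableOn g (Ioi 0)) {c : ℝ}
    (hpos : ∀ t, 0 < t → t ≤ c → 0 ≤ g t) (hneg : ∀ t, 0 < t → c ≤ t → g t ≤ 0)
    (hint : 0 ≤ ∫ t in Ioi (0 : ℝ), g t) {s : ℝ} (hs : 0 ≤ s) :
    0 ≤ ∫ t in Ioi (0 : ℝ), Real.exp (-s * t) * g t := by
  have hle : ∫ t in Ioi (0 : ℝ), g t ≤
      ∫ t in Ioi (0 : ℝ), Real.exp (s * c) * (Real.exp (-s * t) * g t) := by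
    refine setIntegral_mono_on hg ((integrableOn_exp_neg_mul_mul hg hs).const_mul _)
      measurableSet_Ioi fun t ht => ?_
    rw [← mul_assoc, ← Real.exp_add]
    rcases le_total t c with htc | hct
    · exact le_mul_of_one_le_left (hpos t ht htc) (Real.one_le_exp (by nlinarith))
    · have hexp : Real.exp (s * c + -s * t) ≤ 1 := Real.exp_le_one_iff.2 (by nlinarith)
      simpa using mul_le_mul_of_nonpos_right hexp (hneg t ht hct)
  rw [integral_const_mul] at hle
  exact nonneg_of_mul_nonneg_right (hint.trans hle) (Real.exp_pos _)

end LaplaceTransform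

section FourierTransform

variable {f : ℝ → ℝ}

theorem norm_exp_neg_I_mul_mul (t s : ℝ) : ‖Complex.exp (-(Complex.I * t * s))‖ = 1 := by
  simp [Complex.norm_exp]

theorem integrable_exp_neg_I_mul_mul_mul (hf : Integrable f) (t : ℝ) :
    Integrable fun s : ℝ => Complex.exp (-(Complex.I * t * s)) * (f s : ℂ) :=
  hf.ofReal.bdd_mul (Continuous.aestronglyMeasurable (by fun_prop))
    (ae_of_all _ fun s => (norm_exp_neg_I_mul_mul t s).le)

theorem continuous_fourierTransform (hf : Integrable f) : Continuous (fourierTransform f) := by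
  refine continuous_of_dominated (bound := fun s => ‖f s‖)
    (fun t => (integrable_exp_neg_I_mul_mul_mul hf t).aestronglyMeasurable)
    (fun t => ae_of_all _ fun s => ?_) hf.norm (ae_of_all _ fun s => by fun_prop)
  rw [norm_mul, norm_exp_neg_I_mul_mul, one_mul, Complex.norm_real]

end FourierTransform

section LaplaceRepresentation

theorem fourierTransform_density (a t : ℝ) : fourierTransform (density a) t =
    ∫ s in Ioi (0 : ℝ), Complex.exp (-(Complex.I * t * s)) * (Real.exp (-a * s) * phi s : ℝ) := by
  rw [fourierTransform, ← integral_Ici_eq_integral_Ioi, ← integral_indicator measurableSet_Ici]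
  refine integral_congr_ae (ae_of_all _ fun s => ?_)
  by_cases hs : s ∈ Ici (0 : ℝ) <;> simp [density, hs]

theorem fourierTransform_density_eq_laplace (a t : ℝ) : fourierTransform (density a) t =
    ∫ s in Ioi (0 : ℝ), Complex.exp (-(a + t * Complex.I) * s) * (phi s : ℂ) := by
  rw [fourierTransform_density]
  refine setIntegral_congr_fun measurableSet_Ioi fun s _ => ?_
  simp only [Complex.ofReal_mul, Complex.ofReal_exp, ← mul_assoc, ← Complex.exp_add]
  push_cast
  ring_nf

theorem integrable_density {a : ℝ} (ha : 0 < a) : Integrable (density a) := by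
  rw [density, integrable_indicator_iff measurableSet_Ici, integrableOn_Ici_iff_integrableOn_Ioi]
  refine (integrableOn_exp_neg_mul_mul_laplace integrableOn_rho (z := a)
    (by simpa using ha)).re.congr (ae_of_all _ fun s => ?_)
  change (Complex.exp (-a * s) * (phi s : ℂ)).re = _
  rw [Complex.re_mul_ofReal]
  norm_cast

theorem G_conj {z : ℂ} (hz : z ∈ Complex.slitPlane) : G (conj z) = conj (G z) := by
  have hlog := Complex.log_conj z (Complex.slitPlane_arg_ne_pi hz)
  have hlog_add := Complex.log_conj _ (Complex.slitPlane_arg_ne_pi (one_add_mem_slitPlane hz))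
  rw [map_add, map_one] at hlog_add
  simp only [G, hlog, hlog_add, map_mul, map_sub, map_one, map_div₀]

theorem one_sub_G_eq_laplace_of_im_ne_zero {z : ℂ} (hz : 0 < z.re) (him : z.im ≠ 0) :
    1 - G z = ∫ s in Ioi (0 : ℝ), Complex.exp (-z * s) * (phi s : ℂ) := by
  have hupper {w : ℂ} (hre : 0 < w.re) (him : 0 < w.im) :
      1 - G w = ∫ s in Ioi (0 : ℝ), Complex.exp (-w * s) * (phi s : ℂ) :=
    (one_sub_G_eq_stieltjes_of_im_pos him).trans
      (integral_exp_neg_mul_mul_laplace integrableOn_rho hre).symm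
  rcases him.lt_or_gt with hlt | hgt
  · have h := congrArg conj (hupper (w := conj z) (by simpa using hz) (by simpa using hlt))
    rw [G_conj (Or.inl hz), ← integral_conj] at h
    simpa [← Complex.exp_conj] using h
  · exact hupper hz hgt

theorem ofReal_add_mul_I_mem_slitPlane {a : ℝ} (ha : 0 < a) (t : ℝ) :
    (a + t * Complex.I : ℂ) ∈ Complex.slitPlane := Or.inl (by simpa using ha)

theorem analyticOnNhd_one_sub_G_vertical {a : ℝ} (ha : 0 < a) :
    AnalyticOnNhd ℝ (fun t : ℝ => 1 - G (a + t * Complex.I)) univ := by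
  intro t _
  have hdiff : DifferentiableOn ℂ (fun w => 1 - G w) Complex.slitPlane := fun w hw =>
    ((differentiableAt_G hw).const_sub 1).differentiableWithinAt
  have hanalytic := (hdiff.analyticAt (Complex.isOpen_slitPlane.mem_nhds
    (ofReal_add_mul_I_mem_slitPlane ha t))).restrictScalars (𝕜 := ℝ)
  have hline : AnalyticAt ℝ (fun t : ℝ => (a + t * Complex.I : ℂ)) t :=
    analyticAt_const.add ((Complex.ofRealCLM.analyticAt t).mul analyticAt_const)
  exact hanalytic.comp (f := fun t : ℝ => (a + t * Complex.I : ℂ)) hline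

theorem continuous_G_vertical {a : ℝ} (ha : 0 < a) :
    Continuous fun t : ℝ => G (a + t * Complex.I) := by
  have h := (continuous_const (y := (1 : ℂ))).sub
    (continuousOn_univ.1 (analyticOnNhd_one_sub_G_vertical ha).continuousOn)
  simpa only [Pi.sub_def, sub_sub_cancel] using h

theorem one_sub_G_eq_fourierTransform {a : ℝ} (ha : 0 < a) (t : ℝ) :
    1 - G (a + t * Complex.I) = fourierTransform (density a) t := by
  refine congrFun (Continuous.ext_on (dense_compl_singleton (0 : ℝ))
    (continuous_const.sub (continuous_G_vertical ha))
    (continuous_fourierTransform (integrable_density ha)) fun t ht => ?_) t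
  rw [fourierTransform_density_eq_laplace]
  exact one_sub_G_eq_laplace_of_im_ne_zero (by simpa using ha) (by simpa using ht)

theorem one_sub_G_ofReal_eq_stieltjes {a : ℝ} (ha : 0 < a) :
    1 - G a = ((∫ t in Ioi (0 : ℝ), rho t / (t + a) : ℝ) : ℂ) := by
  have h := one_sub_G_eq_fourierTransform ha 0
  rw [fourierTransform_density_eq_laplace, Complex.ofReal_zero, zero_mul, add_zero] at h
  rw [h, ← integral_complex_ofReal]
  push_cast
  exact integral_exp_neg_mul_mul_laplace integrableOn_rho (z := a) (by simpa using ha)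

end LaplaceRepresentation

section Positivity

theorem log_div_log_one_add_mem_Icc {a : ℝ} (ha : 1 ≤ a) :
    Real.log a / Real.log (1 + a) ∈ Icc 0 1 := by
  have hlog : 0 ≤ Real.log a := Real.log_nonneg ha
  have hlog_add : 0 < Real.log (1 + a) := Real.log_pos (by linarith)
  exact ⟨by positivity,
    (div_le_one hlog_add).2 (Real.log_le_log (by linarith) (by linarith))⟩

theorem G_ofReal_nonneg {a : ℝ} (ha : 1 ≤ a) : 0 ≤ G a := by
  rw [G_ofReal (by linarith), Complex.zero_le_real]
  have hratio := (log_div_log_one_add_mem_Icc ha).2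
  exact mul_nonneg (mul_nonneg (by linarith) (by linarith)) (Real.log_nonneg ha)

theorem G_ofReal_re_le_one {a : ℝ} (ha : 1 ≤ a) : (G a).re ≤ 1 := by
  obtain ⟨hratio_nonneg, hratio_le⟩ := log_div_log_one_add_mem_Icc ha
  have hlog_ne : Real.log (1 + a) ≠ 0 := (Real.log_pos (by linarith)).ne'
  have hmul_log_le : a * Real.log ((1 + a) / a) ≤ 1 := by
    calc a * Real.log ((1 + a) / a) ≤ a * ((1 + a) / a - 1) := by
          gcongr
          exact Real.log_le_sub_one_of_pos (by positivity)
      _ = 1 := by field_simp; ring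
  rw [G_ofReal (by linarith), Complex.ofReal_re]
  calc (1 - Real.log a / Real.log (1 + a)) * a * Real.log a
      = a * Real.log ((1 + a) / a) * (Real.log a / Real.log (1 + a)) := by
        rw [Real.log_div (by linarith) (by linarith)]
        field_simp
    _ ≤ 1 * 1 := by gcongr
    _ = 1 := one_mul 1

theorem rho_nonneg_of_sq_add_le {t : ℝ} (ht : 0 < t) (h : t ^ 2 + t ≤ 1) : 0 ≤ rho t := by
  have ht1 : t < 1 := by nlinarith
  rw [rho, if_pos ht1, ← div_neg]
  refine div_nonneg (mul_nonneg ht.le (Real.log_nonneg ?_)) ?_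
  · rw [le_div_iff₀ (by positivity)]
    linarith
  · exact neg_nonneg.2 (Real.log_nonpos (by linarith) (by linarith))

theorem rho_nonpos_of_le_sq_add {t : ℝ} (ht : 0 < t) (h : 1 ≤ t ^ 2 + t) : rho t ≤ 0 := by
  rw [rho]
  split_ifs with hlt
  · refine neg_nonpos.2 (div_nonneg_of_nonpos (mul_nonpos_of_nonneg_of_nonpos ht.le
      (Real.log_nonpos ?_ ?_)) (Real.log_nonpos (by linarith) (by linarith)))
    · exact div_nonneg (by linarith) (by positivity)
    · rw [div_le_one (by positivity)]
      linarith
  · norm_num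
  · rw [neg_nonpos]
    positivity

theorem integral_rho_nonneg : 0 ≤ ∫ t in Ioi (0 : ℝ), rho t := by
  refine ge_of_tendsto (tendsto_mul_integral_div_add_atTop integrableOn_rho) ?_
  filter_upwards [eventually_ge_atTop (1 : ℝ)] with a ha
  have h := congrArg Complex.re (one_sub_G_ofReal_eq_stieltjes (show 0 < a by linarith))
  rw [Complex.ofReal_re, Complex.sub_re, Complex.one_re] at h
  exact mul_nonneg (by linarith) (by linarith [G_ofReal_re_le_one ha])

/- The sign of `ρ` changes at the positive root of `c ^ 2 + c = 1`, where `(1 - t) / t ^ 2`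
passes through `1`. -/
theorem phi_nonneg {s : ℝ} (hs : 0 ≤ s) : 0 ≤ phi s := by
  have hsqrt : √5 ^ 2 = (5 : ℝ) := Real.sq_sqrt (by norm_num)
  have hroot : ((√5 - 1) / 2) ^ 2 + (√5 - 1) / 2 = (1 : ℝ) := by linear_combination hsqrt / 4
  have hone_lt : 1 < √(5 : ℝ) := by rw [Real.lt_sqrt] <;> norm_num
  exact laplace_nonneg_of_sign_change (c := (√5 - 1) / 2) integrableOn_rho
    (fun t ht htc => rho_nonneg_of_sq_add_le ht (by nlinarith [hroot]))
    (fun t ht hct => rho_nonpos_of_le_sq_add ht (by nlinarith [hroot])) integral_rho_nonneg hs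

theorem density_nonneg (a s : ℝ) : 0 ≤ density a s :=
  indicator_nonneg (fun _ hs => mul_nonneg (Real.exp_pos _).le (phi_nonneg hs)) s

end Positivity

section Definiteness

theorem posSemidef_integral {α ι : Type*} [MeasurableSpace α] {μ : Measure α} [Finite ι]
    {A : α → Matrix ι ι ℂ} (hA : ∀ s, (A s).PosSemidef)
    (hint : ∀ i j, Integrable (fun s => A s i j) μ) :
    (Matrix.of fun i j => ∫ s, A s i j ∂μ).PosSemidef := by
  cases nonempty_fintype ι
  refine Matrix.PosSemidef.of_dotProduct_mulVec_nonneg ?_ fun x => ?_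
  · ext i j
    simp only [Matrix.conjTranspose_apply, Matrix.of_apply, Complex.star_def, ← integral_conj]
    exact integral_congr_ae (ae_of_all _ fun s => (hA s).isHermitian.apply i j)
  · have hint_row (i : ι) : Integrable (fun s => (A s).mulVec x i) μ :=
      integrable_finsetSum _ fun j _ => (hint i j).mul_const _
    have hquad : star x ⬝ᵥ (Matrix.of fun i j => ∫ s, A s i j ∂μ).mulVec x =
        ∫ s, star x ⬝ᵥ (A s).mulVec x ∂μ := by
      simp only [dotProduct]
      rw [integral_finsetSum _ fun i _ => (hint_row i).const_mul _]
      refine Finset.sum_congr rfl fun i _ => ?_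
      rw [integral_const_mul]
      simp only [Matrix.mulVec, dotProduct, Matrix.of_apply]
      rw [integral_finsetSum _ fun j _ => (hint i j).mul_const _]
      simp only [integral_mul_const]
    rw [hquad]
    exact integral_nonneg fun s => (hA s).dotProduct_mulVec_nonneg x

theorem isPositiveDefinite_exp_neg_I_mul_mul (s : ℝ) :
    IsPositiveDefinite fun t => Complex.exp (-(Complex.I * t * s)) := by
  intro n x
  convert Matrix.posSemidef_vecMulVec_self_star
    fun i : Fin n => Complex.exp (-(Complex.I * x i * s)) using 1
  ext i j
  rw [Matrix.vecMulVec_apply, Pi.star_apply, Complex.star_def, ← Complex.exp_conj,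
    ← Complex.exp_add, Matrix.of_apply]
  simp only [map_neg, map_mul, Complex.conj_I, Complex.conj_ofReal, Complex.ofReal_sub]
  ring_nf

theorem isPositiveDefinite_fourierTransform {f : ℝ → ℝ} (hf : ∀ s, 0 ≤ f s)
    (hint : Integrable f) : IsPositiveDefinite (fourierTransform f) := fun n x =>
  posSemidef_integral
    (A := fun s : ℝ => Matrix.of fun i j =>
      Complex.exp (-(Complex.I * (x i - x j : ℝ) * s)) * (f s : ℂ))
    (fun s => by
      convert (isPositiveDefinite_exp_neg_I_mul_mul s n x).smul (Complex.zero_le_real.2 (hf s))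
        using 1
      ext i j
      exact mul_comm _ _)
    fun i j => integrable_exp_neg_I_mul_mul_mul hint (x i - x j)

theorem IsPositiveDefinite.apply_neg {f : ℝ → ℂ} (hf : IsPositiveDefinite f) (t : ℝ) :
    f (-t) = conj (f t) := by
  simpa using ((hf 2 ![t, 0]).isHermitian.apply 1 0).symm

/- The matrix attached to `f 0 - f` at the points `x i` is the compression of the one attached to
`f` at the points `0, x 0, …, x (n - 1)` by the vectors `δ_{x i} - δ_0`. -/
theorem IsPositiveDefinite.isNegativeDefinite_zero_sub {f : ℝ → ℂ} (hf : IsPositiveDefinite f) :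
    IsNegativeDefinite fun t => f 0 - f t := by
  intro n x
  let D : Matrix (Fin n) (Fin (n + 1)) ℂ :=
    Matrix.of fun i => Pi.single i.succ 1 - Pi.single 0 1
  convert (hf (n + 1) (Fin.cons 0 x)).mul_mul_conjTranspose_same D using 1
  ext i j
  have hD (v : Fin (n + 1) → ℂ) (i : Fin n) : ∑ k, D i k * v k = v i.succ - v 0 := by
    simp [D, sub_mul, Pi.single_apply]
  have hD_star (v : Fin (n + 1) → ℂ) (j : Fin n) :
      ∑ k, v k * D.conjTranspose k j = v j.succ - v 0 := by
    simp [D, mul_sub, Pi.single_apply]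
  rw [Matrix.mul_apply, hD_star, Matrix.mul_apply, Matrix.mul_apply, hD, hD]
  have hzero : conj (f 0) = f 0 := by rw [← hf.apply_neg, neg_zero]
  simp only [Matrix.of_apply, Fin.cons_succ, Fin.cons_zero, map_sub, hzero, sub_zero, zero_sub,
    hf.apply_neg]
  ring

theorem IsNegativeDefinite.add_const {f : ℝ → ℂ} (hf : IsNegativeDefinite f) {c : ℂ}
    (hc : 0 ≤ c) : IsNegativeDefinite fun t => f t + c := by
  intro n x
  convert (hf n x).add ((Matrix.posSemidef_vecMulVec_self_star (1 : Fin n → ℂ)).smul hc) using 1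
  ext i j
  have hc_conj : conj c = c := Complex.conj_eq_iff_im.2 (Complex.nonneg_iff.1 hc).2.symm
  simp only [Matrix.of_apply, Matrix.add_apply, Matrix.smul_apply, Matrix.vecMulVec_apply,
    Pi.one_apply, star_one, mul_one, smul_eq_mul, map_add, hc_conj]
  ring

theorem IsNegativeDefinite.re_nonneg {f : ℝ → ℂ} (hf : IsNegativeDefinite f) (h0 : f 0 = 0)
    (t : ℝ) : 0 ≤ (f t).re := by
  have h := (hf 1 fun _ => t).diag_nonneg (i := 0)
  simp only [Matrix.of_apply, sub_self, h0, sub_zero, Complex.add_conj] at h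
  linarith [Complex.zero_le_real.1 h]

theorem isPositiveDefinite_one_sub_G_vertical {a : ℝ} (ha : 0 < a) :
    IsPositiveDefinite fun t : ℝ => 1 - G (a + t * Complex.I) := by
  simpa only [one_sub_G_eq_fourierTransform ha] using
    isPositiveDefinite_fourierTransform (density_nonneg a) (integrable_density ha)

theorem isNegativeDefinite_G_vertical_sub {a : ℝ} (ha : 0 < a) :
    IsNegativeDefinite fun t : ℝ => G (a + t * Complex.I) - G a := by
  simpa only [Complex.ofReal_zero, zero_mul, add_zero, sub_sub_sub_cancel_left] using
    (isPositiveDefinite_one_sub_G_vertical ha).isNegativeDefinite_zero_sub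

theorem isNegativeDefinite_G_vertical {a : ℝ} (ha : 1 ≤ a) :
    IsNegativeDefinite fun t : ℝ => G (a + t * Complex.I) := by
  have h := (isNegativeDefinite_G_vertical_sub (show 0 < a by linarith)).add_const
    (G_ofReal_nonneg ha)
  simpa only [sub_add_cancel] using h

end Definiteness

end AlzerG

end

theorem mainTheorem3 :
    -- the integral defining `φ(s)` converges absolutely for every `s ≥ 0`
    (∀ s : ℝ, 0 ≤ s →
      IntegrableOn (fun t : ℝ => Real.exp (-s * t) * AlzerG.rho t) (Ioi 0)) ∧
    -- (i)
    (∀ a : ℝ, 0 < a →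
      AnalyticOnNhd ℝ (fun t : ℝ => 1 - AlzerG.G (a + t * Complex.I)) univ ∧
      AlzerG.IsPositiveDefinite (fun t : ℝ => 1 - AlzerG.G (a + t * Complex.I)) ∧
      Integrable (AlzerG.density a) ∧
      (∀ t : ℝ, 1 - AlzerG.G (a + t * Complex.I) =
        AlzerG.fourierTransform (AlzerG.density a) t) ∧
      (∀ t : ℝ, 1 - AlzerG.G (a + t * Complex.I) =
        ∫ s in Ioi (0 : ℝ), Complex.exp (-(Complex.I * t * s)) *
          (Real.exp (-a * s) * AlzerG.phi s : ℝ))) ∧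
    -- (ii)
    (∀ a : ℝ, 0 < a →
      Continuous (fun t : ℝ => AlzerG.G (a + t * Complex.I) - AlzerG.G a) ∧
      AlzerG.IsNegativeDefinite (fun t : ℝ => AlzerG.G (a + t * Complex.I) - AlzerG.G a) ∧
      (AlzerG.G a).im = 0 ∧
      (∀ t : ℝ, (AlzerG.G a).re ≤ (AlzerG.G (a + t * Complex.I)).re)) ∧
    -- (iii)
    (∀ a : ℝ, 1 ≤ a →
      Continuous (fun t : ℝ => AlzerG.G (a + t * Complex.I)) ∧
      AlzerG.IsNegativeDefinite (fun t : ℝ => AlzerG.G (a + t * Complex.I))) := by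
  refine ⟨fun s hs => AlzerG.integrableOn_exp_neg_mul_mul AlzerG.integrableOn_rho hs,
    fun a ha => ?_, fun a ha => ?_, fun a ha => ?_⟩
  · exact ⟨AlzerG.analyticOnNhd_one_sub_G_vertical ha,
      AlzerG.isPositiveDefinite_one_sub_G_vertical ha, AlzerG.integrable_density ha,
      AlzerG.one_sub_G_eq_fourierTransform ha, fun t =>
        (AlzerG.one_sub_G_eq_fourierTransform ha t).trans (AlzerG.fourierTransform_density a t)⟩
  · have hneg := AlzerG.isNegativeDefinite_G_vertical_sub ha
    have hreal : (AlzerG.G a).im = 0 := by rw [AlzerG.G_ofReal ha, Complex.ofReal_im]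
    refine ⟨(AlzerG.continuous_G_vertical ha).sub continuous_const, hneg, hreal, fun t => ?_⟩
    simpa using hneg.re_nonneg (by simp) t
  · exact ⟨AlzerG.continuous_G_vertical (by linarith), AlzerG.isNegativeDefinite_G_vertical ha⟩
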